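/- Let $r\ge 2$ be an integer and let $X$ be a path-connected ANR, i.e. $X$ is metrizable and every continuous map into $X$ from a closed subset $A$ of a metrizable space $T$ extends continuously to an open neighborhood of $A$ in $T$. Let $PX=C([0,1],X)$ with the compact-open topology and let $p_r\colon PX\to X^r$, $p_r(\gamma)=\big(\gamma(0),\gamma(\tfrac1{r-1}),\dots,\gamma(\tfrac{r-2}{r-1}),\gamma(1)\big)$. For $A\subset X^r$ let the sequential subspace complexity $\mathrm{TC}_{r,X}(A)\in\mathbb N_0\cup\{\infty\}$ be the least $n\geq 0$ for which there are open sets $U_1,\dots,U_n\subset X^r$ with $A\subset\bigcup_i U_i$, each admitting a continuous map $s_i\colon U_i\to PX$ with $p_r\circ s_i=\mathrm{id}_{U_i}$ (and $\infty$ if there is no such $n$); in particular $\mathrm{TC}_{r,X}(\emptyset)=0$. Let $\varphi\colon X^r\to X^r$ be continuous and homotopic to the identity, put $\mathrm{Fix}\,\varphi=\{x\in X^r\mid\varphi(x)=x\}$, and let $F\colon X^r\to\mathbb R$ be a Lyapunov function for $\varphi$, i.e. $F$ is continuous and $F(\varphi(x))\le F(x)$ for all $x\in X^r$. For $\lambda\in\mathbb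 R$ put $F^\lambda=\{x\in X^r\mid F(x)\le\lambda\}$ and $F_\lambda=\{x\in X^r\mid F(x)=\lambda\}$, and for $\mu\in\mathbb R$ let $\mathcal C_\mu(\varphi,F)$ be the set of connected components of $F_\mu\cap\mathrm{Fix}\,\varphi$. Assume that $F$ is bounded from below, that $F(\mathrm{Fix}\,\varphi)\subset\mathbb R$ is discrete, and that $(\varphi,F)$ satisfies condition (D): ($D_1$) $F(\varphi(x))<F(x)$ for all $x\in X^r\setminus\mathrm{Fix}\,\varphi$; ($D_2$) if $A\subset X^r$ is such that $F$ is bounded on $A$ and $\inf\{F(a)-F(\varphi(a))\mid a\in A\}=0$ (with $\inf\emptyset=+\infty$), then $\overline A\cap\mathrm{Fix}\,\varphi\ne\emptyset$. Then: a) For all $\lambda\in\mathbb R$, $$\mathrm{TC}_{r,X}(F^\lambda)\le\sum_{\mu\in(-\infty,\lambda]}\mathrm{TC}_{r,X}(F_\mu\cap\mathrm{Fix}\,\varphi).$$ b) If $\lambda\in\mathbb R$ is such that $\mathcal C_\mu(\varphi,F)$ is finite for all $\mu\le\lambda$, then $$\mathrm{TC}_{r,X}(F^\lambda)\le\sum_{\mu\in(-\infty,\lambda]}\max\{\mathrm{TC}_{r,X}(C)\mid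 C\in\mathcal C_\mu(\varphi,F)\},$$ where the maximum over the empty set is $0$. The sums are taken in $\mathbb N_0\cup\{\infty\}$. -/

import Mathlib

universe u

open scoped unitInterval

/-- A topological space `Y` is an absolute neighborhood retract if it is metrizable and every
continuous map into `Y` from a closed subset of a metrizable space extends continuously to an open
neighborhood of that subset. -/
structure IsANR (Y : Type u) [TopologicalSpace Y] : Prop where
  metrizable : TopologicalSpace.MetrizableSpace Y
  exists_extension : ∀ (T : Type u) [TopologicalSpace T] [TopologicalSpace.MetrizableSpace T]
    (A : Set T), IsClosed A → ∀ f : C(A, Y),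
      ∃ (U : Set T) (hAU : A ⊆ U), IsOpen U ∧
        ∃ g : C(U, Y), ∀ a : A, g ⟨a, hAU a.2⟩ = f a

/-- The time `i / (r - 1)`, for `i = 0, …, r - 1`. -/
noncomputable def sampleTime (r : ℕ) (i : Fin r) : I :=
  ⟨(i : ℝ) / ((r : ℝ) - 1), by
    have h : (i : ℝ) + 1 ≤ r := by exact_mod_cast i.2
    have h0 : (0 : ℝ) ≤ i := Nat.cast_nonneg _
    exact ⟨div_nonneg h0 (by linarith), div_le_one_of_le₀ (by linarith) (by linarith)⟩⟩

/-- The path fibration `p_r : PX → X^r`, `γ ↦ (γ(0), γ(1/(r-1)), …, γ(1))`. The path space `PX` is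
`C(I, X)` with the compact-open topology. -/
noncomputable def pathFibration (r : ℕ) (X : Type u) [TopologicalSpace X] (γ : C(I, X)) :
    Fin r → X :=
  fun i => γ (sampleTime r i)

/-- `A ⊆ X^r` admits a continuous sequential motion planner, i.e. a continuous local section
`A → PX` of the path fibration. -/
def AdmitsMotionPlanner (r : ℕ) (X : Type u) [TopologicalSpace X] (A : Set (Fin r → X)) : Prop :=
  ∃ s : A → C(I, X), Continuous s ∧ ∀ a : A, pathFibration r X (s a) = a

/-- `A ⊆ X^r` is covered by `n` open subsets of `X^r`, each of which admits a continuous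
sequential motion planner. -/
def CoveredByMotionPlanners (r : ℕ) (X : Type u) [TopologicalSpace X] (A : Set (Fin r → X))
    (n : ℕ) : Prop :=
  ∃ U : Fin n → Set (Fin r → X),
    (∀ j, IsOpen (U j) ∧ AdmitsMotionPlanner r X (U j)) ∧ A ⊆ ⋃ j, U j

/-- The `r`-th sequential subspace complexity `TC_{r,X}(A)` of `A ⊆ X^r`: the least `n` such that
`A` is covered by `n` open domains of continuous sequential motion planners, and `∞` if there is no
such `n`. -/
noncomputable def subspaceTC (r : ℕ) (X : Type u) [TopologicalSpace X] (A : Set (Fin r → X)) :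
    ℕ∞ :=
  ⨅ (n : ℕ) (_ : CoveredByMotionPlanners r X A n), (n : ℕ∞)

section LusternikSchnirelmann

variable {Y : Type u} [TopologicalSpace Y]

/-- A Lyapunov function for `φ`: a continuous real function that does not increase along `φ`. -/
structure IsLyapunov (φ : Y → Y) (F : Y → ℝ) : Prop where
  continuous : Continuous F
  apply_le : ∀ y, F (φ y) ≤ F y

/-- Condition (D) for a map `φ` and a Lyapunov function `F` of `φ`. Note that `IsGLB S 0` forces
the set `S` of real numbers to be nonempty. -/
structure ConditionD (φ : Y → Y) (F : Y → ℝ) : Prop where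
  strong : ∀ y, φ y ≠ y → F (φ y) < F y
  closure_inter : ∀ A : Set Y, Bornology.IsBounded (F '' A) →
    IsGLB ((fun a => F a - F (φ a)) '' A) 0 →
      (closure A ∩ Function.fixedPoints φ).Nonempty

/-- The set `F_μ ∩ Fix φ`. -/
def fixedLevel (φ : Y → Y) (F : Y → ℝ) (μ : ℝ) : Set Y :=
  {y | F y = μ} ∩ Function.fixedPoints φ

/-- The set of connected components of `F_μ ∩ Fix φ`, each regarded as a subset of `Y`. -/
def fixedLevelComponents (φ : Y → Y) (F : Y → ℝ) (μ : ℝ) : Set (Set Y) :=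
  {C | ∃ y ∈ fixedLevel φ F μ, C = connectedComponentIn (fixedLevel φ F μ) y}

end LusternikSchnirelmann

/-- Every family in `ℕ∞` is summable, so infinite sums in `ℕ∞` take no default values. -/
theorem ENat.summable_family {ι : Type*} (f : ι → ℕ∞) : Summable f :=
  ⟨_, hasSum_of_isLUB _ (isLUB_iSup (f := fun s : Finset ι => ∑ i ∈ s, f i))⟩

/-! Since `φ` is homotopic to the identity, planners pull back along `φ`, so complexity does not
exceed that of the image under any iterate. Condition (D) bounds the decrease of `F` below by some
`ε > 0` on any closed set without fixed points on which `F` is bounded.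

Suppose finitely many levels contribute and `c` is the highest. Take an open `U` around the fixed
points at level `c` with no larger complexity. Iterating `φ` pushes the sublevel set just above `c`;
one more step takes whatever lies outside `U` strictly below `c`. By subadditivity, level `c` costs
one summand, and induction applies below. If infinitely many levels contribute, the sum is `⊤`.

For b), finitely many disjoint closed components have disjoint open neighbourhoods, and planners
over these glue index by index, so a maximum replaces the sum. -/

/-! ### Motion planners as homotopies between projections -/

section MotionPlanners

variable {r : ℕ} {X : Type u} [TopologicalSpace X]

/-- The `i`-th projection `X^r → X`, restricted to `A`. -/
def restrictedProj (A : Set (Fin r → X)) (i : Fin r) : C(A, X) :=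
  ⟨fun a => a.1 i, (continuous_apply i).comp continuous_subtype_val⟩

/-- Successively homotopic maps are the values at integer times of one map on `ℝ × A`. -/
theorem exists_interpolation {A : Type*} [TopologicalSpace A] (f : ℕ → C(A, X))
    (hf : ∀ k, ContinuousMap.Homotopic (f k) (f (k + 1))) (n : ℕ) :
    ∃ G : C(ℝ × A, X), ∀ k ≤ n, ∀ a, G ((k : ℝ), a) = f k a := by
  induction n with
  | zero =>
    refine ⟨(f 0).comp ⟨Prod.snd, continuous_snd⟩, fun k hk a => ?_⟩
    obtain rfl : k = 0 := by omega
    rfl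
  | succ n ih =>
    obtain ⟨G, hG⟩ := ih
    obtain ⟨H⟩ := hf n
    refine ⟨⟨fun p => if p.1 ≤ n then G p else
      H (Set.projIcc (0 : ℝ) 1 zero_le_one (p.1 - n), p.2), ?_⟩, fun k hk a => ?_⟩
    · refine Continuous.if_le G.continuous ?_ continuous_fst continuous_const ?_
      · refine H.continuous.comp (Continuous.prodMk ?_ continuous_snd)
        exact continuous_projIcc.comp (continuous_fst.sub continuous_const)
      · rintro ⟨t, a⟩ (rfl : t = n)
        simp [hG n le_rfl a]
    · rcases Nat.lt_or_ge n k with h | h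
      · obtain rfl : k = n + 1 := by omega
        simp
      · have h' : (k : ℝ) ≤ n := by exact_mod_cast h
        simp [h', hG k h a]

/-- A continuous motion planner on `A` is the same as homotopies between the projections. -/
theorem admitsMotionPlanner_iff (hr : 2 ≤ r) (A : Set (Fin r → X)) :
    AdmitsMotionPlanner r X A ↔
      ∀ i j, ContinuousMap.Homotopic (restrictedProj A i) (restrictedProj A j) := by
  constructor
  · rintro ⟨s, hs, hsA⟩
    have key : ∀ i, ContinuousMap.Homotopic
        (⟨fun a => s a 0, (continuous_eval_const 0).comp hs⟩ : C(A, X))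
        (restrictedProj A i) := by
      intro i
      refine ⟨⟨⟨fun p => s p.2 (p.1 * sampleTime r i), ?_⟩, fun a => ?_, fun a => ?_⟩⟩
      · have h1 : Continuous fun p : I × A => s p.2 := hs.comp continuous_snd
        have h2 : Continuous fun p : I × A => p.1 * sampleTime r i :=
          continuous_fst.mul continuous_const
        exact h1.eval h2
      · simp
      · simpa [restrictedProj, pathFibration] using congrFun (hsA a) i
    exact fun i j => (key i).symm.trans (key j)
  · intro h
    -- The value for `k ≥ r` is a filler that keeps consecutive maps homotopic for every `k`.
    let f : ℕ → C(A, X) := fun k => if hk : k < r then restrictedProj A ⟨k, hk⟩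
      else restrictedProj A ⟨0, by omega⟩
    have hf : ∀ k, ContinuousMap.Homotopic (f k) (f (k + 1)) := by
      intro k
      dsimp only [f]
      split_ifs <;> exact h _ _
    obtain ⟨G, hG⟩ := exists_interpolation f hf r
    -- Rescaling time by `r - 1` moves the `i`-th sample time to the integer `i`.
    let g : C(A × I, X) := G.comp ⟨fun p => (((r : ℝ) - 1) * (p.2 : ℝ), p.1), by fun_prop⟩
    refine ⟨g.curry, g.curry.continuous, fun a => funext fun i => ?_⟩
    have hr' : (r : ℝ) - 1 ≠ 0 := by
      have : (2 : ℝ) ≤ r := by exact_mod_cast hr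
      linarith
    have h1 : ((r : ℝ) - 1) * (sampleTime r i : ℝ) = (i : ℕ) := by
      simp only [sampleTime]
      field_simp
    change G (((r : ℝ) - 1) * (sampleTime r i : ℝ), a) = a.1 i
    rw [h1, hG i i.2.le]
    simp [f, restrictedProj]

theorem AdmitsMotionPlanner.preimage (hr : 2 ≤ r) {U : Set (Fin r → X)}
    (hU : AdmitsMotionPlanner r X U) {φ : C(Fin r → X, Fin r → X)}
    (hφ : ContinuousMap.Homotopic φ (ContinuousMap.id (Fin r → X))) :
    AdmitsMotionPlanner r X (φ ⁻¹' U) := by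
  rw [admitsMotionPlanner_iff hr] at hU ⊢
  let ψ : C(φ ⁻¹' U, U) := ⟨fun a => ⟨φ a.1, a.2⟩, by fun_prop⟩
  let ι : C(φ ⁻¹' U, Fin r → X) := ⟨Subtype.val, continuous_subtype_val⟩
  let π : ∀ i : Fin r, C(Fin r → X, X) := fun i => ⟨fun x => x i, continuous_apply i⟩
  have key : ∀ i, ContinuousMap.Homotopic ((restrictedProj U i).comp ψ)
      (restrictedProj (φ ⁻¹' U) i) := fun i =>
    ((ContinuousMap.Homotopic.refl (π i)).comp hφ).comp (ContinuousMap.Homotopic.refl ι)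
  exact fun i j => (key i).symm.trans
    (((hU i j).comp (ContinuousMap.Homotopic.refl ψ)).trans (key j))

theorem AdmitsMotionPlanner.mono {A B : Set (Fin r → X)} (h : A ⊆ B)
    (hB : AdmitsMotionPlanner r X B) : AdmitsMotionPlanner r X A := by
  obtain ⟨s, hs, hsB⟩ := hB
  exact ⟨s ∘ Set.inclusion h, hs.comp (continuous_inclusion h),
    fun a => hsB (Set.inclusion h a)⟩

theorem admitsMotionPlanner_empty : AdmitsMotionPlanner r X ∅ :=
  ⟨fun a => a.2.elim, continuous_of_const fun a => a.2.elim, fun a => a.2.elim⟩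

theorem AdmitsMotionPlanner.union {U V : Set (Fin r → X)} (hU : IsOpen U) (hV : IsOpen V)
    (hUV : Disjoint U V) (hsU : AdmitsMotionPlanner r X U) (hsV : AdmitsMotionPlanner r X V) :
    AdmitsMotionPlanner r X (U ∪ V) := by
  classical
  obtain ⟨s, hs, hsU⟩ := hsU
  obtain ⟨t, ht, htV⟩ := hsV
  have hmem : ∀ a : ↥(U ∪ V), a.1 ∉ U → a.1 ∈ V := fun a ha => a.2.resolve_left ha
  refine ⟨fun a => if h : a.1 ∈ U then s ⟨a.1, h⟩ else t ⟨a.1, hmem a h⟩, ?_, fun a => ?_⟩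
  · rw [continuous_iff_continuousAt]
    intro a
    by_cases h : a.1 ∈ U
    · have hO : IsOpen {b : ↥(U ∪ V) | b.1 ∈ U} := hU.preimage continuous_subtype_val
      refine ContinuousOn.continuousAt (s := {b : ↥(U ∪ V) | b.1 ∈ U}) ?_ (hO.mem_nhds h)
      rw [continuousOn_iff_continuous_domRestrict]
      have : Continuous fun b : {b : ↥(U ∪ V) | b.1 ∈ U} => s ⟨b.1.1, b.2⟩ :=
        hs.comp (by fun_prop)
      refine this.congr fun b => ?_
      have hb : b.1.1 ∈ U := b.2
      simp [hb]
    · have hO : IsOpen {b : ↥(U ∪ V) | b.1 ∈ V} := hV.preimage continuous_subtype_val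
      refine ContinuousOn.continuousAt (s := {b : ↥(U ∪ V) | b.1 ∈ V}) ?_ (hO.mem_nhds (hmem a h))
      rw [continuousOn_iff_continuous_domRestrict]
      have : Continuous fun b : {b : ↥(U ∪ V) | b.1 ∈ V} => t ⟨b.1.1, b.2⟩ :=
        ht.comp (by fun_prop)
      refine this.congr fun b => ?_
      have hb : b.1.1 ∉ U := Set.disjoint_right.1 hUV b.2
      simp [hb]
  · by_cases h : a.1 ∈ U
    · simpa [h] using hsU ⟨a.1, h⟩
    · simpa [h] using htV ⟨a.1, hmem a h⟩

end MotionPlanners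

/-! ### Monotonicity, subadditivity and homotopy properties of the complexity -/

section SubspaceTC

variable {r : ℕ} {X : Type u} [TopologicalSpace X] {A B : Set (Fin r → X)}

theorem CoveredByMotionPlanners.subset {n : ℕ} (h : A ⊆ B)
    (hB : CoveredByMotionPlanners r X B n) : CoveredByMotionPlanners r X A n :=
  let ⟨U, hU, hBU⟩ := hB
  ⟨U, hU, h.trans hBU⟩

theorem CoveredByMotionPlanners.union {m n : ℕ} (hA : CoveredByMotionPlanners r X A m)
    (hB : CoveredByMotionPlanners r X B n) : CoveredByMotionPlanners r X (A ∪ B) (m + n) := by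
  obtain ⟨U, hU, hAU⟩ := hA
  obtain ⟨V, hV, hBV⟩ := hB
  refine ⟨Fin.append U V, fun j => ?_, ?_⟩
  · refine Fin.addCases (fun i => ?_) (fun i => ?_) j
    · simpa using hU i
    · simpa using hV i
  · rintro x (hx | hx)
    · obtain ⟨i, hi⟩ := Set.mem_iUnion.1 (hAU hx)
      exact Set.mem_iUnion.2 ⟨Fin.castAdd n i, by simpa using hi⟩
    · obtain ⟨i, hi⟩ := Set.mem_iUnion.1 (hBV hx)
      exact Set.mem_iUnion.2 ⟨Fin.natAdd m i, by simpa using hi⟩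

theorem coveredByMotionPlanners_empty (n : ℕ) : CoveredByMotionPlanners r X ∅ n :=
  ⟨fun _ => ∅, fun _ => ⟨isOpen_empty, admitsMotionPlanner_empty⟩, Set.empty_subset _⟩

theorem CoveredByMotionPlanners.mono {m n : ℕ} (h : m ≤ n)
    (hA : CoveredByMotionPlanners r X A m) : CoveredByMotionPlanners r X A n := by
  obtain ⟨k, rfl⟩ := Nat.exists_eq_add_of_le h
  simpa using hA.union (coveredByMotionPlanners_empty k)

theorem subspaceTC_le_coe_iff {n : ℕ} :
    subspaceTC r X A ≤ n ↔ CoveredByMotionPlanners r X A n := by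
  refine ⟨fun h => ?_, fun h => iInf₂_le n h⟩
  have h' : subspaceTC r X A < ((n + 1 : ℕ) : ℕ∞) :=
    h.trans_lt (by exact_mod_cast Nat.lt_succ_self n)
  simp only [subspaceTC, iInf_lt_iff] at h'
  obtain ⟨m, hm, hmn⟩ := h'
  have : m < n + 1 := by exact_mod_cast hmn
  exact hm.mono (by omega)

theorem subspaceTC_mono (h : A ⊆ B) : subspaceTC r X A ≤ subspaceTC r X B :=
  le_iInf₂ fun n hn => iInf₂_le n (hn.subset h)

theorem subspaceTC_empty : subspaceTC r X ∅ = 0 :=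
  nonpos_iff_eq_zero.1 (by
    exact_mod_cast subspaceTC_le_coe_iff.2 (coveredByMotionPlanners_empty (r := r) (X := X) 0))

theorem one_le_subspaceTC (hA : A.Nonempty) : 1 ≤ subspaceTC r X A := by
  rw [Order.one_le_iff_ne_zero]
  intro h
  obtain ⟨U, -, hAU⟩ := subspaceTC_le_coe_iff.1 (show subspaceTC r X A ≤ (0 : ℕ) by simp [h])
  obtain ⟨x, hx⟩ := hA
  obtain ⟨i, -⟩ := Set.mem_iUnion.1 (hAU hx)
  exact i.elim0

theorem subspaceTC_union_le :
    subspaceTC r X (A ∪ B) ≤ subspaceTC r X A + subspaceTC r X B := by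
  generalize ha : subspaceTC r X A = a
  generalize hb : subspaceTC r X B = b
  induction a with
  | top => simp
  | coe m =>
    induction b with
    | top => simp
    | coe n =>
      exact_mod_cast subspaceTC_le_coe_iff.2
        ((subspaceTC_le_coe_iff.1 ha.le).union (subspaceTC_le_coe_iff.1 hb.le))

theorem exists_isOpen_superset_subspaceTC_le (A : Set (Fin r → X)) :
    ∃ U, IsOpen U ∧ A ⊆ U ∧ subspaceTC r X U ≤ subspaceTC r X A := by
  generalize ha : subspaceTC r X A = a
  induction a with
  | top => exact ⟨Set.univ, isOpen_univ, Set.subset_univ A, le_top⟩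
  | coe n =>
    obtain ⟨U, hU, hAU⟩ := subspaceTC_le_coe_iff.1 ha.le
    exact ⟨⋃ j, U j, isOpen_iUnion fun j => (hU j).1, hAU,
      subspaceTC_le_coe_iff.2 ⟨U, hU, subset_rfl⟩⟩

theorem subspaceTC_le_image (hr : 2 ≤ r) {φ : C(Fin r → X, Fin r → X)}
    (hφ : ContinuousMap.Homotopic φ (ContinuousMap.id (Fin r → X))) (A : Set (Fin r → X)) :
    subspaceTC r X A ≤ subspaceTC r X (φ '' A) := by
  refine le_iInf₂ fun n hn => subspaceTC_le_coe_iff.2 ?_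
  obtain ⟨U, hU, hAU⟩ := hn
  refine ⟨fun j => φ ⁻¹' U j, fun j =>
    ⟨(hU j).1.preimage φ.continuous, (hU j).2.preimage hr hφ⟩, fun x hx => ?_⟩
  simpa using hAU (Set.mem_image_of_mem φ hx)

theorem subspaceTC_le_of_mapsTo_iterate (hr : 2 ≤ r) {φ : C(Fin r → X, Fin r → X)}
    (hφ : ContinuousMap.Homotopic φ (ContinuousMap.id (Fin r → X))) (n : ℕ)
    (h : Set.MapsTo φ^[n] A B) : subspaceTC r X A ≤ subspaceTC r X B := by
  induction n generalizing A with
  | zero => exact subspaceTC_mono h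
  | succ n ih =>
    refine (subspaceTC_le_image hr hφ A).trans (ih ?_)
    rintro _ ⟨x, hx, rfl⟩
    exact h hx

/-- Cutting both covers down to disjoint neighbourhoods lets the `j`-th planners of each be glued
into one. -/
theorem subspaceTC_union_le_max [NormalSpace (Fin r → X)] (hA : IsClosed A) (hB : IsClosed B)
    (hAB : Disjoint A B) :
    subspaceTC r X (A ∪ B) ≤ max (subspaceTC r X A) (subspaceTC r X B) := by
  generalize hn : max (subspaceTC r X A) (subspaceTC r X B) = n
  induction n with
  | top => exact le_top
  | coe n =>
    obtain ⟨U, hU, hAU⟩ := subspaceTC_le_coe_iff.1 ((le_max_left _ _).trans hn.le)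
    obtain ⟨V, hV, hBV⟩ := subspaceTC_le_coe_iff.1 ((le_max_right _ _).trans hn.le)
    obtain ⟨O, P, hO, hP, hAO, hBP, hOP⟩ := normal_separation hA hB hAB
    refine subspaceTC_le_coe_iff.2 ⟨fun j => U j ∩ O ∪ V j ∩ P, fun j =>
      ⟨((hU j).1.inter hO).union ((hV j).1.inter hP), ?_⟩, ?_⟩
    · exact ((hU j).2.mono Set.inter_subset_left).union ((hU j).1.inter hO) ((hV j).1.inter hP)
        (hOP.mono Set.inter_subset_right Set.inter_subset_right)
        ((hV j).2.mono Set.inter_subset_left)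
    · rintro x (hx | hx)
      · obtain ⟨i, hi⟩ := Set.mem_iUnion.1 (hAU hx)
        exact Set.mem_iUnion.2 ⟨i, Or.inl ⟨hi, hAO hx⟩⟩
      · obtain ⟨i, hi⟩ := Set.mem_iUnion.1 (hBV hx)
        exact Set.mem_iUnion.2 ⟨i, Or.inr ⟨hi, hBP hx⟩⟩

theorem subspaceTC_sUnion_le_iSup [NormalSpace (Fin r → X)] {S : Set (Set (Fin r → X))}
    (hS : S.Finite) (hcl : ∀ C ∈ S, IsClosed C) (hdisj : S.PairwiseDisjoint id) :
    subspaceTC r X (⋃₀ S) ≤ ⨆ C ∈ S, subspaceTC r X C := by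
  induction S, hS using Set.Finite.induction_on with
  | empty => simp [subspaceTC_empty]
  | @insert C S hC hS ih =>
    rw [Set.sUnion_insert, iSup_insert]
    have hclS : ∀ D ∈ S, IsClosed D := fun D hD => hcl D (Set.mem_insert_of_mem C hD)
    refine (subspaceTC_union_le_max (hcl C (Set.mem_insert C S)) (Set.sUnion_eq_biUnion ▸ hS.isClosed_biUnion hclS)
      ?_).trans (max_le_max le_rfl (ih hclS (hdisj.subset (Set.subset_insert C S))))
    refine Set.disjoint_sUnion_right.2 fun D hD => ?_
    exact hdisj (Set.mem_insert C S) (Set.mem_insert_of_mem C hD) fun h => hC (h ▸ hD)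

end SubspaceTC

/-! ### Descent of the Lyapunov function along iterates -/

section Descent

theorem isBounded_image_of_forall_mem_Icc {Y : Type*} {F : Y → ℝ} {B : Set Y} {a b : ℝ}
    (h : ∀ y ∈ B, a ≤ F y ∧ F y ≤ b) : Bornology.IsBounded (F '' B) :=
  (Metric.isBounded_Icc a b).subset (by rintro _ ⟨y, hy, rfl⟩; exact h y hy)

variable {Y : Type u} [TopologicalSpace Y] {φ : Y → Y} {F : Y → ℝ}

/-- Otherwise the decrease has infimum `0` on `B`, and `closure_inter` yields a fixed point in
`closure B = B`. -/
theorem ConditionD.exists_uniform_decrease (hD : ConditionD φ F) (hF : IsLyapunov φ F) {B : Set Y}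
    (hB : IsClosed B) (hbdd : Bornology.IsBounded (F '' B)) (hfix : ∀ y ∈ B, φ y ≠ y) :
    ∃ ε > 0, ∀ y ∈ B, F (φ y) ≤ F y - ε := by
  by_contra! h
  obtain ⟨y, hyB, hy⟩ : (closure B ∩ Function.fixedPoints φ).Nonempty := by
    refine hD.closure_inter B hbdd ⟨?_, fun b hb => ?_⟩
    · rintro _ ⟨y, -, rfl⟩
      exact sub_nonneg.2 (hF.apply_le y)
    · by_contra! hb0
      obtain ⟨y, hy, hlt⟩ := h b hb0
      have : b ≤ F y - F (φ y) := hb ⟨y, hy, rfl⟩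
      linarith
  exact hfix y (hB.closure_eq ▸ hyB) hy

theorem IsLyapunov.iterate_le (hF : IsLyapunov φ F) (n : ℕ) (y : Y) : F (φ^[n] y) ≤ F y := by
  induction n with
  | zero => rfl
  | succ n ih => exact (Function.iterate_succ_apply' φ n y ▸ hF.apply_le _).trans ih

theorem ConditionD.exists_iterate_le (hD : ConditionD φ F) (hF : IsLyapunov φ F) {a b : ℝ}
    (hfix : ∀ y, a ≤ F y → F y ≤ b → φ y ≠ y) :
    ∃ n : ℕ, ∀ y, F y ≤ b → F (φ^[n] y) ≤ a := by
  obtain ⟨ε, hε, hdec⟩ := hD.exists_uniform_decrease hF (B := {y | a ≤ F y} ∩ {y | F y ≤ b})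
    ((isClosed_le continuous_const hF.continuous).inter
      (isClosed_le hF.continuous continuous_const))
    (isBounded_image_of_forall_mem_Icc fun _ hy => hy) fun y hy => hfix y hy.1 hy.2
  -- Each step costs `ε` while the value is at least `a`; once below `a`, it stays there.
  have key : ∀ (n : ℕ) y, F y ≤ b → F (φ^[n] y) ≤ max a (b - n * ε) := by
    intro n y hy
    induction n with
    | zero => simp [hy]
    | succ n ih =>
      rw [Function.iterate_succ_apply']
      rcases le_total a (F (φ^[n] y)) with h | h
      · have h1 := hdec _ ⟨h, (hF.iterate_le n y).trans hy⟩
        rcases le_max_iff.1 ih with h2 | h2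
        · exact le_max_of_le_left (by linarith)
        · exact le_max_of_le_right (by push_cast; linarith)
      · exact le_max_of_le_left ((hF.apply_le _).trans h)
  obtain ⟨n, hn⟩ := exists_nat_gt ((b - a) / ε)
  rw [div_lt_iff₀ hε] at hn
  exact ⟨n, fun y hy => (key n y hy).trans (max_le le_rfl (by linarith))⟩

end Descent

/-! ### Induction over the critical levels -/

section Sublevels

variable {r : ℕ} {X : Type u} [TopologicalSpace X] {φ : C(Fin r → X, Fin r → X)}
  {F : (Fin r → X) → ℝ}

theorem subspaceTC_sublevel_le_sum (hr : 2 ≤ r)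
    (hφ : ContinuousMap.Homotopic φ (ContinuousMap.id (Fin r → X))) (hF : IsLyapunov φ F)
    (hbdd : BddBelow (Set.range F)) (hD : ConditionD φ F) (S : Finset ℝ) :
    ∀ l : ℝ, (∀ μ ∈ S, μ ≤ l) → (∀ y, φ y = y → F y ≤ l → F y ∈ S) →
      subspaceTC r X {x | F x ≤ l} ≤ ∑ μ ∈ S, subspaceTC r X (fixedLevel φ F μ) := by
  induction S using Finset.induction_on_max with
  | empty =>
    intro l _ hS
    -- Without fixed points, iteration would push the sublevel set below the lower bound of `F`, so
    -- it is empty.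
    obtain ⟨m, hm⟩ := hbdd
    obtain ⟨n, hn⟩ := hD.exists_iterate_le hF (a := m - 1) (b := l)
      fun y _ hy hfix => by simpa using hS y hfix hy
    have : {x | F x ≤ l} = ∅ := Set.eq_empty_of_forall_notMem fun x hx => by
      have h1 := hn x hx
      have h2 : m ≤ F (φ^[n] x) := hm ⟨_, rfl⟩
      linarith
    simp [this, subspaceTC_empty]
  | insert c S hc ih =>
    intro l hl hS
    rw [Finset.sum_insert fun h => (hc c h).false]
    obtain ⟨U, hUo, hKU, hU⟩ := exists_isOpen_superset_subspaceTC_le (fixedLevel φ F c)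
    obtain ⟨a, hSa, hac⟩ : ∃ a, (∀ μ ∈ S, μ < a) ∧ a < c := by
      have h1 : ∀ᶠ a in nhdsWithin c (Set.Iio c), ∀ μ ∈ S, μ < a :=
        (Filter.eventually_all_finset S).2 fun μ hμ =>
          eventually_nhdsWithin_of_eventually_nhds (eventually_gt_nhds (hc μ hμ))
      exact (h1.and self_mem_nhdsWithin).exists
    obtain ⟨ε, hε, hdec⟩ := hD.exists_uniform_decrease hF
      (B := Uᶜ ∩ ({y | a ≤ F y} ∩ {y | F y ≤ l}))
      (hUo.isClosed_compl.inter ((isClosed_le continuous_const hF.continuous).inter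
        (isClosed_le hF.continuous continuous_const)))
      (isBounded_image_of_forall_mem_Icc fun _ hy => hy.2) (by
        rintro y ⟨hyU, hya, hyl⟩ hy
        rcases Finset.mem_insert.1 (hS y hy hyl) with h | h
        · exact hyU (hKU ⟨h, hy⟩)
        · exact (hSa _ h).not_ge hya)
    -- With margin `ε / 2` above `c`, a single drop by `ε` ends at `c - ε / 2` or lower. Since `c +
    -- ε / 2` may exceed `l`, the bound `F x ≤ l` is carried along.
    obtain ⟨n, hn⟩ := hD.exists_iterate_le hF (a := c + ε / 2) (b := l) (by
      intro y hya hyl hy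
      rcases Finset.mem_insert.1 (hS y hy hyl) with h | h
      · linarith
      · linarith [hc _ h])
    have hcl : c ≤ l := hl c (Finset.mem_insert_self c S)
    have hlt : max a (c - ε / 2) < c := max_lt hac (by linarith)
    calc subspaceTC r X {x | F x ≤ l}
        ≤ subspaceTC r X {x | F x ≤ c + ε / 2 ∧ F x ≤ l} :=
          subspaceTC_le_of_mapsTo_iterate hr hφ n fun y hy =>
            ⟨hn y hy, (hF.iterate_le n y).trans hy⟩
      _ ≤ subspaceTC r X (U ∪ {x | F x ≤ c + ε / 2 ∧ F x ≤ l} \ U) :=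
          subspaceTC_mono (by rw [Set.union_sdiff_self]; exact Set.subset_union_right)
      _ ≤ _ := subspaceTC_union_le.trans (add_le_add hU ?_)
    refine (subspaceTC_le_of_mapsTo_iterate (B := {x | F x ≤ max a (c - ε / 2)}) hr hφ 1
      ?_).trans (ih _ (fun μ hμ => (hSa μ hμ).le.trans (le_max_left _ _)) fun y hy hyl => ?_)
    · rintro y ⟨⟨hyc, hyl⟩, hyU⟩
      change F (φ y) ≤ _
      rcases le_total a (F y) with h | h
      · exact le_max_of_le_right (by linarith [hdec y ⟨hyU, h, hyl⟩])
      · exact le_max_of_le_left ((hF.apply_le y).trans h)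
    · exact (Finset.mem_insert.1 (hS y hy ((hyl.trans hlt.le).trans hcl))).resolve_left
        (hyl.trans_lt hlt).ne

theorem ENat.tsum_eq_top_of_infinite_support {ι : Type*} {f : ι → ℕ∞}
    (h : (Function.support f).Infinite) : ∑' i, f i = ⊤ := by
  refine ENat.eq_top_iff_forall_ge.2 fun n => ?_
  obtain ⟨t, ht, rfl⟩ := h.exists_subset_card_eq n
  calc (t.card : ℕ∞) = ∑ _i ∈ t, 1 := by simp
    _ ≤ ∑ i ∈ t, f i :=
      Finset.sum_le_sum fun i hi => Order.one_le_iff_ne_zero.2 (ht hi)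
    _ ≤ ∑' i, f i := (ENat.summable_family f).sum_le_tsum t fun _ _ => zero_le

theorem subspaceTC_sublevel_le_tsum (hr : 2 ≤ r)
    (hφ : ContinuousMap.Homotopic φ (ContinuousMap.id (Fin r → X))) (hF : IsLyapunov φ F)
    (hbdd : BddBelow (Set.range F)) (hD : ConditionD φ F) (l : ℝ) :
    subspaceTC r X {x | F x ≤ l} ≤ ∑' μ : Set.Iic l, subspaceTC r X (fixedLevel φ F μ) := by
  rcases (Function.support fun μ : Set.Iic l =>
    subspaceTC r X (fixedLevel φ F μ)).finite_or_infinite with h | h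
  -- The support contains every critical value up to `l`, because a nonempty set has complexity at
  -- least `1`.
  · have hS := subspaceTC_sublevel_le_sum hr hφ hF hbdd hD
      (h.toFinset.map (Function.Embedding.subtype _)) l (by
        intro μ hμ
        obtain ⟨ν, -, rfl⟩ := Finset.mem_map.1 hμ
        exact ν.2) (by
        intro y hy hyl
        refine Finset.mem_map.2 ⟨⟨F y, hyl⟩, ?_, rfl⟩
        rw [Set.Finite.mem_toFinset, Function.mem_support, ← Order.one_le_iff_ne_zero]
        exact one_le_subspaceTC ⟨y, rfl, hy⟩)
    rw [Finset.sum_map] at hS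
    exact hS.trans ((ENat.summable_family _).sum_le_tsum _ fun _ _ => zero_le)
  · rw [ENat.tsum_eq_top_of_infinite_support h]
    exact le_top

theorem subspaceTC_fixedLevel_le_iSup [T4Space (Fin r → X)] (hF : Continuous F) (μ : ℝ)
    (hfin : (fixedLevelComponents φ F μ).Finite) :
    subspaceTC r X (fixedLevel φ F μ) ≤
      ⨆ C ∈ fixedLevelComponents φ F μ, subspaceTC r X C := by
  have hcl : IsClosed (fixedLevel φ F μ) :=
    (isClosed_eq hF continuous_const).inter (isClosed_fixedPoints φ.continuous)
  have hsub : fixedLevel φ F μ ⊆ ⋃₀ fixedLevelComponents φ F μ := fun y hy =>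
    Set.mem_sUnion.2 ⟨_, ⟨y, hy, rfl⟩, mem_connectedComponentIn hy⟩
  refine (subspaceTC_mono hsub).trans
    (subspaceTC_sUnion_le_iSup hfin ?_ ?_)
  · rintro _ ⟨y, hy, rfl⟩
    rw [connectedComponentIn_eq_image hy]
    exact hcl.isClosedEmbedding_subtypeVal.isClosedMap _ isClosed_connectedComponent
  · rintro _ ⟨y, hy, rfl⟩ _ ⟨z, hz, rfl⟩ hyz
    refine Set.disjoint_left.2 fun w hwy hwz => hyz ?_
    exact (connectedComponentIn_eq hwy).trans (connectedComponentIn_eq hwz).symm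

end Sublevels

theorem theorem2p9 (r : ℕ) (hr : 2 ≤ r) (X : Type u) [TopologicalSpace X] [PathConnectedSpace X]
    (hX : IsANR X) (φ : C(Fin r → X, Fin r → X))
    (hφ : ContinuousMap.Homotopic φ (ContinuousMap.id (Fin r → X)))
    (F : (Fin r → X) → ℝ) (hF : IsLyapunov φ F) (hbdd : BddBelow (Set.range F))
    (hdisc : IsDiscrete (F '' Function.fixedPoints φ)) (hD : ConditionD φ F) :
    (∀ l : ℝ, subspaceTC r X {x | F x ≤ l} ≤
      ∑' μ : Set.Iic l, subspaceTC r X (fixedLevel φ F μ)) ∧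
    (∀ l : ℝ, (∀ μ ≤ l, (fixedLevelComponents φ F μ).Finite) →
      subspaceTC r X {x | F x ≤ l} ≤
        ∑' μ : Set.Iic l, ⨆ C ∈ fixedLevelComponents φ F μ, subspaceTC r X C) := by

  have := hX.metrizable
  refine ⟨subspaceTC_sublevel_le_tsum hr hφ hF hbdd hD, fun l hfin => ?_⟩
  exact (subspaceTC_sublevel_le_tsum hr hφ hF hbdd hD l).trans
    ((ENat.summable_family _).tsum_le_tsum
      (fun μ => subspaceTC_fixedLevel_le_iSup hF.continuous μ (hfin μ μ.2))
      (ENat.summable_family _))
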